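/- Let $q\in\mathbb N$, $\alpha\in\mathbb R$ and $\kappa\in\mathbb N_0\cup\{+\infty\}$. All sequences below consist of complex $q\times q$ matrices, and $A^\dagger$ denotes the Moore–Penrose inverse of a complex matrix $A$. Definitions. For a sequence $(s_j)_{j=0}^{\kappa}$ let $H_n^{\langle s\rangle}=[s_{j+k}]_{j,k=0}^{n}$ (for $2n\le\kappa$), and, if $\kappa\ge1$, let $s^{(\alpha)}_j=-\alpha s_j+s_{j+1}$ for $0\le j\le\kappa-1$. (a) For $m\in\mathbb N_0$, the set $\mathcal K^{\ge}_{q,m,\alpha}$ consists of all sequences $(s_j)_{j=0}^m$ such that: if $m=0$, $H_0^{\langle s\rangle}=s_0$ is non-negative Hermitian; if $m=2n$ with $n\ge1$, $H_n^{\langle s\rangle}$ and $H_{n-1}^{\langle s^{(\alpha)}\rangle}$ are non-negative Hermitian; if $m=2n+1$ with $n\ge 0$, $H_n^{\langle s\rangle}$ and $H_n^{\langle s^{(\alpha)}\rangle}$ are non-negative Hermitian. For $m\in\mathbb N_0$, the set $\mathcal K^{\ge,e}_{q,m,\alpha}$ consists of all $(s_j)_{j=0}^m$ for which there is a complex $q\times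 q$ matrix $s_{m+1}$ with $(s_j)_{j=0}^{m+1}\in\mathcal K^{\ge}_{q,m+1,\alpha}$. Finally, $\mathcal K^{\ge,e}_{q,\infty,\alpha}$ consists of all $(s_j)_{j=0}^\infty$ with $(s_j)_{j=0}^m\in\mathcal K^{\ge}_{q,m,\alpha}$ for all $m\in\mathbb N_0$. (b) Let $L_0^{\langle s\rangle}=s_0$ and, for $n\ge1$ with $2n\le\kappa$, $$L_n^{\langle s\rangle}=s_{2n}-[s_n,s_{n+1},\dots,s_{2n-1}]\,\bigl(H_{n-1}^{\langle s\rangle}\bigr)^\dagger\begin{bmatrix}s_n\\ s_{n+1}\\ \vdots\\ s_{2n-1}\end{bmatrix}.$$ The (right) $\alpha$-Stieltjes parametrization of $(s_j)_{j=0}^\kappa$ is the sequence $(Q_j)_{j=0}^\kappa$ given by $Q_{2k}=L_k^{\langle s\rangle}$ for $2k\le\kappa$ and $Q_{2k+1}=L_k^{\langle s^{(\alpha)}\rangle}$ for $2k+1\le\kappa$. (c) The reciprocal sequence $(u_j^\sharp)_{j=0}^\kappa$ of a sequence $(u_j)_{j=0}^\kappa$ is given by $u_0^\sharp=u_0^\dagger$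 and $u_j^\sharp=-u_0^\dagger\sum_{l=0}^{j-1}u_{j-l}u_l^\sharp$ for $1\le j\le\kappa$. If $\kappa\ge1$, the first $\alpha$-Schur–Stieltjes transform of $(s_j)_{j=0}^\kappa$ is the sequence $(-s_0u_{j+1}^\sharp s_0)_{j=0}^{\kappa-1}$, where $u_0=s_0$ and $u_j=-\alpha s_{j-1}+s_j$ for $1\le j\le\kappa$. The $0$-th $\alpha$-Schur–Stieltjes transform of $(s_j)_{j=0}^\kappa$ is $(s_j)_{j=0}^\kappa$ itself, and for $1\le k\le\kappa$ the $k$-th one, of the form $(t_j)_{j=0}^{\kappa-k}$, is the first transform of the $(k-1)$-th one. Theorem. Let $(s_j)_{j=0}^\kappa\in\mathcal K^{\ge,e}_{q,\kappa,\alpha}$, and let $k$ be an integer with $0\le k\le\kappa$. Denote by $(t_j)_{j=0}^{\kappa-k}$ the $k$-th $\alpha$-Schur–Stieltjes transform of $(s_j)_{j=0}^\kappa$ and by $(Q_j)_{j=0}^\kappa$ the $\alpha$-Stieltjes parametrization of $(s_j)_{j=0}^\kappa$. Then $(Q_{k+j})_{j=0}^{\kappa-k}$ is exactly the $\alpha$-Stieltjes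 parametrization of $(t_j)_{j=0}^{\kappa-k}$. -/

import Mathlib

open scoped Matrix ComplexOrder

/-! Matrices over `ℂ`. A finite or infinite sequence `(s_j)_{j=0}^κ`, `κ ∈ ℕ ∪ {∞}`, is encoded as
a function `s : ℕ → Matrix _ _ ℂ` together with `κ : ℕ∞`; entries of index `> κ` are irrelevant: every
notion below with index `j` (or length `κ`) involves only the entries it may involve. -/

namespace StieltjesSchur

/-- The four Penrose equations: `X` is a Moore-Penrose inverse of `A`. -/
structure IsMoorePenrose {m n : Type*} [Fintype m] [Fintype n]
    (A : Matrix m n ℂ) (X : Matrix n m ℂ) : Prop where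
  mul_mul_self : A * X * A = A
  self_mul_mul : X * A * X = X
  left_herm : (A * X)ᴴ = A * X
  right_herm : (X * A)ᴴ = X * A

theorem exists_isMoorePenrose {m n : Type*} [Fintype m] [Fintype n]
    (A : Matrix m n ℂ) : ∃ X : Matrix n m ℂ, IsMoorePenrose A X := by
  classical
  obtain ⟨H, hHdef⟩ : ∃ H, H = Aᴴ * A := ⟨_, rfl⟩
  have hH : H.IsHermitian := by rw [hHdef]; exact Matrix.isHermitian_conjTranspose_mul_self A
  obtain ⟨G, hG, hGH, hHGH, hGHG⟩ : ∃ G : Matrix n n ℂ,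
      Gᴴ = G ∧ G * H = H * G ∧ H * G * H = H ∧ G * H * G = G := by
    obtain ⟨U, hUdef⟩ : ∃ U : Matrix n n ℂ, U = (hH.eigenvectorUnitary : Matrix n n ℂ) := ⟨_, rfl⟩
    obtain ⟨d, hd⟩ : ∃ d : n → ℂ, d = fun i => (hH.eigenvalues i : ℂ) := ⟨_, rfl⟩
    have hU : Uᴴ * U = 1 := by
      rw [hUdef]; exact Unitary.coe_star_mul_self hH.eigenvectorUnitary
    have hspec : H = U * Matrix.diagonal d * Uᴴ := by
      have h := hH.spectral_theorem
      rw [Unitary.conjStarAlgAut_apply] at h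
      rw [hUdef, hd]
      exact h
    have key : ∀ a b : n → ℂ, (U * Matrix.diagonal a * Uᴴ) * (U * Matrix.diagonal b * Uᴴ)
        = U * Matrix.diagonal (fun i => a i * b i) * Uᴴ := by
      intro a b
      calc (U * Matrix.diagonal a * Uᴴ) * (U * Matrix.diagonal b * Uᴴ)
          = U * Matrix.diagonal a * (Uᴴ * U) * Matrix.diagonal b * Uᴴ := by
            simp only [Matrix.mul_assoc]
        _ = _ := by
            rw [hU, Matrix.mul_one, Matrix.mul_assoc U, Matrix.diagonal_mul_diagonal]
    refine ⟨U * Matrix.diagonal (fun i => (d i)⁻¹) * Uᴴ, ?_, ?_, ?_, ?_⟩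
    · rw [Matrix.conjTranspose_mul, Matrix.conjTranspose_mul, Matrix.conjTranspose_conjTranspose,
        Matrix.diagonal_conjTranspose, Matrix.mul_assoc]
      congr 3
      ext i
      simp [hd]
    · rw [hspec, key, key]
      simp only [mul_comm]
    · rw [hspec, key, key]
      congr 3
      ext i
      by_cases h : d i = 0 <;> simp [h]
    · rw [hspec, key, key]
      congr 3
      ext i
      by_cases h : d i = 0 <;> simp [h]
  refine ⟨G * Aᴴ, ?_, ?_, ?_, ?_⟩
  · have h1 : A * (G * Aᴴ) * A = A * G * H := by rw [hHdef]; simp only [Matrix.mul_assoc]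
    rw [h1, ← sub_eq_zero, ← Matrix.conjTranspose_mul_self_eq_zero]
    have h2 : (A * G * H - A)ᴴ * (A * G * H - A) = (H * G - 1) * (H * G * H - H) := by
      have e1 : (A * G * H - A)ᴴ = (H * G - 1) * Aᴴ := by
        rw [Matrix.conjTranspose_sub, Matrix.conjTranspose_mul, Matrix.conjTranspose_mul, hG,
          hH.eq, Matrix.sub_mul, Matrix.one_mul, Matrix.mul_assoc]
      rw [e1, Matrix.mul_assoc, Matrix.mul_sub]
      congr 2
      · rw [hHdef]
        simp only [Matrix.mul_assoc]
      · exact hHdef.symm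
    rw [h2, hHGH, sub_self, Matrix.mul_zero]
  · calc G * Aᴴ * A * (G * Aᴴ) = G * (Aᴴ * A) * G * Aᴴ := by simp only [Matrix.mul_assoc]
      _ = G * Aᴴ := by rw [← hHdef, hGHG]
  · rw [Matrix.conjTranspose_mul, Matrix.conjTranspose_mul, hG, Matrix.conjTranspose_conjTranspose,
      Matrix.mul_assoc]
  · rw [Matrix.mul_assoc, ← hHdef, Matrix.conjTranspose_mul, hG, hH.eq, hGH]

theorem IsMoorePenrose.unique {m n : Type*} [Fintype m] [Fintype n]
    {A : Matrix m n ℂ} {X Y : Matrix n m ℂ} (hX : IsMoorePenrose A X) (hY : IsMoorePenrose A Y) :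
    X = Y := by
  have h1 : A * X = A * Y := by
    calc A * X = (A * X)ᴴ := hX.left_herm.symm
      _ = ((A * Y) * (A * X))ᴴ := by rw [← Matrix.mul_assoc, hY.mul_mul_self]
      _ = (A * X) * (A * Y) := by rw [Matrix.conjTranspose_mul, hX.left_herm, hY.left_herm]
      _ = A * Y := by rw [← Matrix.mul_assoc, hX.mul_mul_self]
  have h2 : X * A = Y * A := by
    calc X * A = (X * A)ᴴ := hX.right_herm.symm
      _ = ((X * A) * (Y * A))ᴴ := by
        rw [Matrix.mul_assoc, ← Matrix.mul_assoc A Y, hY.mul_mul_self]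
      _ = (Y * A) * (X * A) := by rw [Matrix.conjTranspose_mul, hX.right_herm, hY.right_herm]
      _ = Y * A := by rw [Matrix.mul_assoc, ← Matrix.mul_assoc A X, hX.mul_mul_self]
  calc X = X * A * X := hX.self_mul_mul.symm
    _ = Y * A * Y := by rw [h2, Matrix.mul_assoc, h1, ← Matrix.mul_assoc]
    _ = Y := hY.self_mul_mul

/-- The Moore-Penrose inverse `A†` of a complex matrix. -/
noncomputable def moorePenrose {m n : Type*} [Fintype m] [Fintype n]
    (A : Matrix m n ℂ) : Matrix n m ℂ :=
  Classical.choose (exists_isMoorePenrose A)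

theorem moorePenrose_spec {m n : Type*} [Fintype m] [Fintype n] (A : Matrix m n ℂ) :
    IsMoorePenrose A (moorePenrose A) :=
  Classical.choose_spec (exists_isMoorePenrose A)

/-- The block Hankel matrix `H_n = [s_{j+k}]_{j,k=0}^n`. -/
def blockHankel {p q : ℕ} (s : ℕ → Matrix (Fin p) (Fin q) ℂ) (n : ℕ) :
    Matrix (Fin (n + 1) × Fin p) (Fin (n + 1) × Fin q) ℂ :=
  Matrix.of fun a b => s (a.1.val + b.1.val) a.2 b.2

/-- The block column `col (s_j)_{j=l}^{l+n}`. -/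
def blockCol {p q : ℕ} (s : ℕ → Matrix (Fin p) (Fin q) ℂ) (l n : ℕ) :
    Matrix (Fin (n + 1) × Fin p) (Fin q) ℂ :=
  Matrix.of fun a b => s (l + a.1.val) a.2 b

/-- The block row `[s_l, s_{l+1}, …, s_{l+n}]`. -/
def blockRow {p q : ℕ} (s : ℕ → Matrix (Fin p) (Fin q) ℂ) (l n : ℕ) :
    Matrix (Fin p) (Fin (n + 1) × Fin q) ℂ :=
  Matrix.of fun a b => s (l + b.1.val) a b.2

/-- `L_0 = s_0` and `L_n = s_{2n} - [s_n, …, s_{2n-1}] (H_{n-1})† col(s_n, …, s_{2n-1})`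
for `n ≥ 1`. -/
noncomputable def schurComplement {p q : ℕ} (s : ℕ → Matrix (Fin p) (Fin q) ℂ) :
    ℕ → Matrix (Fin p) (Fin q) ℂ
  | 0 => s 0
  | n + 1 => s (2 * (n + 1)) -
      blockRow s (n + 1) n * moorePenrose (blockHankel s n) * blockCol s (n + 1) n

/-- The right `α`-shifted sequence, `-α s_j + s_{j+1}`. -/
noncomputable def alphaShift {p q : ℕ} (α : ℂ) (s : ℕ → Matrix (Fin p) (Fin q) ℂ) :
    ℕ → Matrix (Fin p) (Fin q) ℂ :=
  fun j => -(α • s j) + s (j + 1)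

/-- The right `α`-Stieltjes parametrization `(Q_j)` of `(s_j)`: `Q_{2k}` is `L_k` formed from `s`,
`Q_{2k+1}` is `L_k` formed from the right `α`-shifted sequence. -/
noncomputable def stieltjesParam {p q : ℕ} (α : ℂ) (s : ℕ → Matrix (Fin p) (Fin q) ℂ) :
    ℕ → Matrix (Fin p) (Fin q) ℂ :=
  fun j => if Even j then schurComplement s (j / 2) else schurComplement (alphaShift α s) (j / 2)

/-- Membership of `(s_j)_{j=0}^m` in `K^≥_{q,m,α}`, `α`-Stieltjes non-negative definite sequences:
for `m = 0`, `H_0` is non-negative Hermitian; for `m = 2n` with `n ≥ 1`, `H_n` formed from `s` and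
`H_{n-1}` formed from the right `α`-shifted sequence are; for `m = 2n+1`, both `H_n` are. -/
def IsStieltjesNND {q : ℕ} (α : ℝ) (m : ℕ) (s : ℕ → Matrix (Fin q) (Fin q) ℂ) : Prop :=
  (blockHankel s (m / 2)).PosSemidef ∧
    (1 ≤ m → (blockHankel (alphaShift (α : ℂ) s) ((m - 1) / 2)).PosSemidef)

/-- Membership of `(s_j)_{j=0}^κ` in `K^{≥,e}_{q,κ,α}`, `κ ∈ ℕ ∪ {∞}`: for `κ = m` finite, there
is a matrix `s_{m+1}` such that `(s_j)_{j=0}^{m+1}` lies in `K^≥_{q,m+1,α}`; for `κ = ∞`, every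
`(s_j)_{j=0}^m` lies in `K^≥_{q,m,α}`. -/
def IsStieltjesNNDExt {q : ℕ} (α : ℝ) (κ : ℕ∞) (s : ℕ → Matrix (Fin q) (Fin q) ℂ) : Prop :=
  (∀ m : ℕ, κ = (m : ℕ∞) → ∃ X : Matrix (Fin q) (Fin q) ℂ,
    IsStieltjesNND α (m + 1) (Function.update s (m + 1) X)) ∧
  (κ = ⊤ → ∀ m : ℕ, IsStieltjesNND α m s)

/-- The reciprocal sequence `(s_j^♯)`: `s_0^♯ = s_0†` and
`s_j^♯ = -s_0† ∑_{l=0}^{j-1} s_{j-l} s_l^♯` for `j ≥ 1`. -/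
noncomputable def reciprocalSeq {p q : ℕ} (s : ℕ → Matrix (Fin p) (Fin q) ℂ) :
    ℕ → Matrix (Fin q) (Fin p) ℂ
  | 0 => moorePenrose (s 0)
  | j + 1 => -(moorePenrose (s 0) *
      ∑ l : Fin (j + 1), s (j + 1 - l.val) * reciprocalSeq s l.val)
  termination_by j => j
  decreasing_by exact l.isLt

/-- The `[+,α]`-transform `-α s_{j-1} + s_j`, where `s_{-1} = 0`. -/
noncomputable def plusTransform {p q : ℕ} (α : ℂ) (s : ℕ → Matrix (Fin p) (Fin q) ℂ) :
    ℕ → Matrix (Fin p) (Fin q) ℂ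
  | 0 => s 0
  | j + 1 => -(α • s j) + s (j + 1)

/-- The first `α`-Schur-Stieltjes transform `(s_0 (-u_{j+1}^♯) s_0)_j`, where `(u_j^♯)` is the
reciprocal sequence of the `[+,α]`-transform `(u_j)` of `(s_j)`. It shortens a sequence by one. -/
noncomputable def schurStep {p q : ℕ} (α : ℂ) (s : ℕ → Matrix (Fin p) (Fin q) ℂ) :
    ℕ → Matrix (Fin p) (Fin q) ℂ :=
  fun j => s 0 * (-(reciprocalSeq (plusTransform α s) (j + 1))) * s 0

/-- The `k`-th `α`-Schur-Stieltjes transform of `(s_j)`. -/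
noncomputable def schurTransform {p q : ℕ} (α : ℂ) (s : ℕ → Matrix (Fin p) (Fin q) ℂ) :
    ℕ → (ℕ → Matrix (Fin p) (Fin q) ℂ)
  | 0 => s
  | k + 1 => schurStep α (schurTransform α s k)

end StieltjesSchur

/-! A Schur complement is the residual of a linear system: if `p` has last block 1 and H_n p = (0,
…, 0, L), then L = L_n, even for singular H_{n-1}, provided H_n is Hermitian
(`schurComplement_eq_of_hasMonicSol`). It therefore suffices to carry such monic solutions through
one Schur–Stieltjes step.

Write s(z) = ∑ s_j z^j and similarly for the other sequences; put G = s_0†, a = s^{(α)}, let t be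
the first transform and b = t^{(α)}. If s_0 G s_j = s_j = s_j G s_0, then t = a - z a G t = a - z t
G a. Hence t (1 + zGa) = a, and a triangular block Toeplitz change of unknowns turns a solution for
a into one for t with the same residual: L_n(t) = L_n(a), that is, Q_{2n} of t is Q_{2n+1} of s
(`HasMonicSol.of_rightRec`). Eliminating a gives z b G s = (s - s_0)/z - s_1 G s, in which α no
longer occurs (`alphaShift_rec`); by the same device L_n(b) = L_{n+1}(s), the odd case
(`HasMonicSol.of_shiftedRec`).

To iterate without proving that transforms are again non-negative definite, only some algebraic
consequences are kept (`IsStieltjesRegular`): Hermitian entries, monic solutions, and ker Q_j ⊆ ker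
Q_{j+1}. The inclusions yield the range conditions on s_0 and pass to t because its parameters are
those of s shifted. Positivity and extendability enter only in establishing these properties for the
initial sequence (`IsStieltjesNND.isStieltjesRegular`). -/

namespace StieltjesSchur

open Finset

/-! ### Transport of monic Hankel solutions through convolution recursions -/

section Algebra

variable {R : Type*} [Ring R]

/-- `p` is a monic solution of degree `n` of the Hankel system of `s`, with residual `L`:
`H_n p = (0, …, 0, L)` and `p_n = 1`. -/
def HasMonicSol (s : ℕ → R) (n : ℕ) (L : R) : Prop :=
  ∃ p : ℕ → R, p n = 1 ∧ (∀ i < n, ∑ k ∈ range (n + 1), s (i + k) * p k = 0) ∧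
    ∑ k ∈ range (n + 1), s (n + k) * p k = L

/-- Moves the unit upper triangular Toeplitz factor 1 + zy from the vector `p` to the row `t`.
Triangularity makes the truncation at `N` harmless. -/
theorem sum_mul_upperToeplitz (t y p : ℕ → R) (N : ℕ) :
    ∑ k ∈ range N, t k * (p k + ∑ j ∈ range N, if k < j then y (j - 1 - k) * p j else 0) =
      ∑ j ∈ range N, (t j + ∑ k ∈ range j, t k * y (j - 1 - k)) * p j := by
  simp only [mul_add, add_mul, sum_add_distrib, mul_sum, sum_mul]
  congr 1
  rw [sum_comm]
  refine sum_congr rfl fun j hj => ?_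
  have hj' := mem_range.1 hj
  have : range j = (range N).filter (· < j) := by
    ext x; simp only [mem_range, mem_filter]; omega
  rw [this, sum_filter]
  refine sum_congr rfl fun k _ => ?_
  split_ifs <;> simp [mul_assoc]

/-- The hypothesis says t (1 + zGa) = a, so the new solution is the Toeplitz matrix of 1 + zGa
applied to `p`. In row i, the convolution terms with l < i are multiples of earlier rows of the
system for `a`, which vanish. -/
theorem HasMonicSol.of_rightRec {a t : ℕ → R} {G L : R} {n : ℕ}
    (h : ∀ m ≤ 2 * n, t m = a m - ∑ l ∈ range m, t l * (G * a (m - 1 - l)))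
    (ha : HasMonicSol a n L) : HasMonicSol t n L := by
  obtain ⟨p, hp1, hp0, hpL⟩ := ha
  have key : ∀ i ≤ n, ∑ k ∈ range (n + 1), t (i + k) *
      (p k + ∑ j ∈ range (n + 1), if k < j then (G * a (j - 1 - k)) * p j else 0) =
      ∑ j ∈ range (n + 1), a (i + j) * p j := by
    intro i hi
    rw [sum_mul_upperToeplitz (fun k => t (i + k)) (fun k => G * a k) p]
    have h1 : ∀ j ∈ range (n + 1),
        (t (i + j) + ∑ k ∈ range j, t (i + k) * (G * a (j - 1 - k))) * p j =
        a (i + j) * p j - ∑ k ∈ range i, t k * G * (a ((i - 1 - k) + j) * p j) := by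
      intro j hj
      have hj' := mem_range.1 hj
      rw [h (i + j) (by omega), sum_range_add]
      have h2 : ∑ k ∈ range j, t (i + k) * (G * a (j - 1 - k)) =
          ∑ k ∈ range j, t (i + k) * (G * a (i + j - 1 - (i + k))) := by
        refine sum_congr rfl fun k hk => ?_
        have := mem_range.1 hk
        rw [show i + j - 1 - (i + k) = j - 1 - k by omega]
      have h3 : ∑ k ∈ range i, t k * G * (a ((i - 1 - k) + j) * p j) =
          (∑ k ∈ range i, t k * (G * a (i + j - 1 - k))) * p j := by
        rw [sum_mul]
        refine sum_congr rfl fun k hk => ?_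
        have := mem_range.1 hk
        rw [show i + j - 1 - k = i - 1 - k + j by omega]
        simp only [mul_assoc]
      rw [h2, h3, ← sub_mul]
      congr 1
      abel
    rw [sum_congr rfl h1, sum_sub_distrib, sum_comm, sub_eq_self]
    refine sum_eq_zero fun k hk => ?_
    have := mem_range.1 hk
    rw [← mul_sum, hp0 _ (by omega), mul_zero]
  refine ⟨fun k => p k + ∑ j ∈ range (n + 1), if k < j then (G * a (j - 1 - k)) * p j else 0,
    ?_, fun i hi => ?_, ?_⟩
  · beta_reduce
    rw [hp1, add_eq_left]
    refine sum_eq_zero fun j hj => ?_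
    have := mem_range.1 hj
    rw [if_neg (by omega)]
  · exact (key i hi.le).trans (hp0 i hi)
  · exact (key n le_rfl).trans hpL

/-- Dropping p_0 and applying a unit triangular Toeplitz matrix lowers the degree by one: row i for
`b` becomes row i + 1 for `s`. The hypothesis `h0` removes the contribution of the dropped block. -/
theorem HasMonicSol.of_shiftedRec {s b : ℕ → R} {G L : R} {n : ℕ}
    (h : ∀ m ≤ 2 * n, b m = s (m + 2) - s 1 * (G * s (m + 1)) -
      ∑ l ∈ range m, b l * (G * s (m - 1 - l + 1)))
    (h0 : ∀ i ≤ n, s (i + 1) - s 1 * (G * s i) - ∑ l ∈ range i, b l * (G * s (i - 1 - l)) = 0)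
    (hs : HasMonicSol s (n + 1) L) : HasMonicSol b n L := by
  obtain ⟨p, hp1, hp0, hpL⟩ := hs
  have tail : ∀ i, ∑ j ∈ range (n + 1), s (i + 1 + j) * p (j + 1) =
      ∑ k ∈ range (n + 1 + 1), s (i + k) * p k - s i * p 0 := by
    intro i
    rw [sum_range_succ' _ (n + 1), add_zero, add_sub_cancel_right]
    refine sum_congr rfl fun j _ => ?_
    rw [show i + 1 + j = i + (j + 1) by omega]
  have key : ∀ i ≤ n, ∑ k ∈ range (n + 1), b (i + k) *
      (p (k + 1) + ∑ j ∈ range (n + 1),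
        if k < j then (G * s (j - 1 - k + 1)) * p (j + 1) else 0) =
      ∑ j ∈ range (n + 1 + 1), s (i + 1 + j) * p j := by
    intro i hi
    rw [sum_mul_upperToeplitz (fun k => b (i + k)) (fun k => G * s (k + 1)) (fun k => p (k + 1))]
    have h1 : ∀ j ∈ range (n + 1),
        (b (i + j) + ∑ k ∈ range j, b (i + k) * (G * s (j - 1 - k + 1))) * p (j + 1) =
        s (i + 1 + 1 + j) * p (j + 1) - s 1 * G * (s (i + 1 + j) * p (j + 1)) -
          ∑ k ∈ range i, b k * G * (s ((i - 1 - k) + 1 + j) * p (j + 1)) := by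
      intro j hj
      have hj' := mem_range.1 hj
      rw [h (i + j) (by omega), sum_range_add]
      have h2 : ∑ k ∈ range j, b (i + k) * (G * s (j - 1 - k + 1)) =
          ∑ k ∈ range j, b (i + k) * (G * s (i + j - 1 - (i + k) + 1)) := by
        refine sum_congr rfl fun k hk => ?_
        have := mem_range.1 hk
        rw [show i + j - 1 - (i + k) = j - 1 - k by omega]
      have h3 : ∑ k ∈ range i, b k * G * (s ((i - 1 - k) + 1 + j) * p (j + 1)) =
          (∑ k ∈ range i, b k * (G * s (i + j - 1 - k + 1))) * p (j + 1) := by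
        rw [sum_mul]
        refine sum_congr rfl fun k hk => ?_
        have := mem_range.1 hk
        rw [show i + j - 1 - k + 1 = i - 1 - k + 1 + j by omega]
        simp only [mul_assoc]
      rw [h2, h3, show i + j + 2 = i + 1 + 1 + j by omega, show i + j + 1 = i + 1 + j by omega]
      noncomm_ring
    rw [sum_congr rfl h1, sum_sub_distrib, sum_sub_distrib, sum_comm, ← mul_sum, tail, tail]
    have h4 : ∑ k ∈ range i, ∑ j ∈ range (n + 1),
        b k * G * (s ((i - 1 - k) + 1 + j) * p (j + 1)) =
        -((∑ k ∈ range i, b k * (G * s (i - 1 - k))) * p 0) := by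
      rw [sum_mul, ← sum_neg_distrib]
      refine sum_congr rfl fun k hk => ?_
      have := mem_range.1 hk
      rw [← mul_sum, tail, hp0 _ (by omega)]
      noncomm_ring
    rw [h4, hp0 i (by omega)]
    -- Apart from row i + 1 of the system for `s`, only multiples of `p 0` remain, and their total
    -- coefficient is minus the left side of `h0`.
    have h5 := congrArg (· * p 0) (h0 i hi)
    simp only [sub_mul, zero_mul] at h5
    linear_combination (norm := noncomm_ring) -h5
  refine ⟨fun k => p (k + 1) + ∑ j ∈ range (n + 1),
    if k < j then (G * s (j - 1 - k + 1)) * p (j + 1) else 0, ?_, fun i hi => ?_, ?_⟩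
  · beta_reduce
    rw [hp1, add_eq_left]
    refine sum_eq_zero fun j hj => ?_
    have := mem_range.1 hj
    rw [if_neg (by omega)]
  · exact (key i hi.le).trans (hp0 (i + 1) (by omega))
  · exact (key n le_rfl).trans hpL

/-- The formal identity (1 + zaG)⁻¹ a = a (1 + zGa)⁻¹. Expanding each recursion once by the other
leaves matching single sums and matching double sums. -/
theorem rightRec_of_leftRec {a t : ℕ → R} {G : R} {N : ℕ}
    (h : ∀ m ≤ N, t m = a m - ∑ l ∈ range m, a (m - 1 - l) * (G * t l)) :
    ∀ m ≤ N, t m = a m - ∑ l ∈ range m, t l * (G * a (m - 1 - l)) := by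
  intro m
  induction m using Nat.strong_induction_on with
  | _ m ih =>
    intro hm
    rw [h m hm, sub_right_inj]
    have h1 : ∑ l ∈ range m, a (m - 1 - l) * (G * t l) =
        ∑ l ∈ range m, a (m - 1 - l) * (G * a l) -
          ∑ l ∈ range m, ∑ k ∈ range l, a (m - 1 - l) * G * t k * G * a (l - 1 - k) := by
      rw [← sum_sub_distrib]
      refine sum_congr rfl fun l hl => ?_
      have := mem_range.1 hl
      rw [ih l this (by omega), mul_sub, mul_sub, mul_sum, mul_sum]
      simp only [mul_assoc]
    have h2 : ∑ l ∈ range m, t l * (G * a (m - 1 - l)) =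
        ∑ l ∈ range m, a l * (G * a (m - 1 - l)) -
          ∑ l ∈ range m, ∑ k ∈ range l, a (l - 1 - k) * G * t k * G * a (m - 1 - l) := by
      rw [← sum_sub_distrib]
      refine sum_congr rfl fun l hl => ?_
      have := mem_range.1 hl
      rw [h l (by omega), sub_mul, sum_mul]
      simp only [mul_assoc]
    rw [h1, h2]
    congr 1
    · rw [← sum_range_reflect]
      refine sum_congr rfl fun l hl => ?_
      have := mem_range.1 hl
      rw [show m - 1 - (m - 1 - l) = l by omega]
    · rw [sum_sigma', sum_sigma']
      -- With k fixed, the involution l ↦ m + k - l exchanges the indices m - 1 - l and l - 1 - k of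
      -- the two outer factors.
      refine sum_nbij' (fun x => ⟨m + x.2 - x.1, x.2⟩) (fun x => ⟨m + x.2 - x.1, x.2⟩)
        ?_ ?_ ?_ ?_ ?_
      · rintro ⟨x, y⟩ hx
        simp only [mem_sigma, mem_range] at hx ⊢
        omega
      · rintro ⟨x, y⟩ hx
        simp only [mem_sigma, mem_range] at hx ⊢
        omega
      · rintro ⟨x, y⟩ hx
        simp only [mem_sigma, mem_range] at hx
        simp only [Sigma.mk.injEq, heq_eq_eq, and_true]
        omega
      · rintro ⟨x, y⟩ hx
        simp only [mem_sigma, mem_range] at hx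
        simp only [Sigma.mk.injEq, heq_eq_eq, and_true]
        omega
      · rintro ⟨x, y⟩ hx
        simp only [mem_sigma, mem_range] at hx
        simp only
        rw [show m + y - x - 1 - y = m - 1 - x by omega,
          show m - 1 - (m + y - x) = x - 1 - y by omega]

end Algebra
-- Block Hankel matrices, null vectors and Schur complements
section BlockHankel

variable {q : ℕ} {ι : Type*}

/-- The block column `col (w_j)_{j=0}^n`. -/
def blockStack (w : ℕ → Matrix (Fin q) ι ℂ) (n : ℕ) : Matrix (Fin (n + 1) × Fin q) ι ℂ :=
  Matrix.of fun a b => w a.1.val a.2 b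

theorem sum_block_mul (n : ℕ) (x : ℕ → Matrix (Fin q) (Fin q) ℂ) (w : ℕ → Matrix (Fin q) ι ℂ)
    (i : Fin q) (b : ι) :
    ∑ c : Fin (n + 1) × Fin q, x c.1.val i c.2 * w c.1.val c.2 b =
      (∑ k ∈ range (n + 1), x k * w k) i b := by
  rw [Fintype.sum_prod_type, Matrix.sum_apply,
    ← Fin.sum_univ_eq_sum_range (fun k => (x k * w k) i b)]
  rfl

theorem blockHankel_mul_blockStack (s : ℕ → Matrix (Fin q) (Fin q) ℂ)
    (w : ℕ → Matrix (Fin q) ι ℂ) (n : ℕ) :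
    blockHankel s n * blockStack w n =
      blockStack (fun i => ∑ k ∈ range (n + 1), s (i + k) * w k) n := by
  ext a b
  exact sum_block_mul n (fun k => s (a.1.val + k)) w a.2 b

theorem blockRow_mul_blockStack (s : ℕ → Matrix (Fin q) (Fin q) ℂ)
    (w : ℕ → Matrix (Fin q) ι ℂ) (l n : ℕ) :
    blockRow s l n * blockStack w n = ∑ k ∈ range (n + 1), s (l + k) * w k := by
  ext a b
  exact sum_block_mul n (fun k => s (l + k)) w a b

theorem conjTranspose_blockStack_mul (v : ℕ → Matrix (Fin q) (Fin q) ℂ)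
    (w : ℕ → Matrix (Fin q) ι ℂ) (n : ℕ) :
    (blockStack v n)ᴴ * blockStack w n = ∑ k ∈ range (n + 1), (v k)ᴴ * w k := by
  ext a b
  exact sum_block_mul n (fun k => (v k)ᴴ) w a b

theorem blockStack_surj {n : ℕ} (W : Matrix (Fin (n + 1) × Fin q) ι ℂ) :
    ∃ w : ℕ → Matrix (Fin q) ι ℂ, blockStack w n = W := by
  refine ⟨fun k => Matrix.of fun i b => if h : k < n + 1 then W (⟨k, h⟩, i) b else 0, ?_⟩
  ext a b
  simp only [blockStack, Matrix.of_apply]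
  rw [dif_pos a.1.isLt]

theorem blockStack_inj {n : ℕ} {v w : ℕ → Matrix (Fin q) ι ℂ}
    (h : blockStack v n = blockStack w n) : ∀ i ≤ n, v i = w i := by
  intro i hi
  ext a b
  exact congrFun (congrFun h (⟨i, by omega⟩, a)) b

theorem blockStack_congr {n : ℕ} {v w : ℕ → Matrix (Fin q) ι ℂ}
    (h : ∀ i ≤ n, v i = w i) : blockStack v n = blockStack w n := by
  ext a b
  exact congrFun (congrFun (h _ (Nat.lt_succ_iff.1 a.1.isLt)) a.2) b

theorem conjTranspose_blockHankel {s : ℕ → Matrix (Fin q) (Fin q) ℂ} {n : ℕ}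
    (hs : ∀ j ≤ 2 * n, (s j)ᴴ = s j) : (blockHankel s n)ᴴ = blockHankel s n := by
  ext a b
  have h := hs (a.1.val + b.1.val) (by have := a.1.isLt; have := b.1.isLt; omega)
  rw [blockHankel, Matrix.conjTranspose_apply, Matrix.of_apply, Matrix.of_apply,
    add_comm b.1.val, ← Matrix.conjTranspose_apply, h]

theorem conjTranspose_eq_of_isHermitian_blockHankel {s : ℕ → Matrix (Fin q) (Fin q) ℂ} {n : ℕ}
    (h : (blockHankel s n).IsHermitian) : ∀ j ≤ 2 * n, (s j)ᴴ = s j := by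
  intro j hj
  ext a b
  have h1 := congrFun (congrFun h.eq (⟨j / 2, by omega⟩, a)) (⟨j - j / 2, by omega⟩, b)
  simp only [blockHankel, Matrix.conjTranspose_apply, Matrix.of_apply] at h1
  rw [show j - j / 2 + j / 2 = j by omega, show j / 2 + (j - j / 2) = j by omega] at h1
  exact h1

theorem posSemidef_blockHankel_of_le {s : ℕ → Matrix (Fin q) (Fin q) ℂ} {m n : ℕ} (h : m ≤ n)
    (hn : (blockHankel s n).PosSemidef) : (blockHankel s m).PosSemidef :=
  hn.submatrix fun a : Fin (m + 1) × Fin q => (Fin.castLE (by omega) a.1, a.2)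

theorem mul_eq_zero_of_posSemidef {m : Type*} [Fintype m] {A : Matrix m m ℂ} {W : Matrix m ι ℂ}
    [Fintype ι] (hA : A.PosSemidef) (h : Wᴴ * (A * W) = 0) : A * W = 0 := by
  ext a b
  have h1 : star (W.col b) ⬝ᵥ (A *ᵥ W.col b) = (Wᴴ * (A * W)) b b := rfl
  rw [h, Matrix.zero_apply] at h1
  exact congrFun ((hA.dotProduct_mulVec_zero_iff _).1 h1) a

/-- A null vector of a leading principal block of a non-negative Hermitian block Hankel matrix,
padded with a zero block, is a null vector of the whole matrix. -/
theorem sum_mul_eq_zero_of_posSemidef [Fintype ι] {s : ℕ → Matrix (Fin q) (Fin q) ℂ} {n : ℕ}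
    (hs : (blockHankel s (n + 1)).PosSemidef) {w : ℕ → Matrix (Fin q) ι ℂ}
    (hw : ∀ i ≤ n, ∑ k ∈ range (n + 1), s (i + k) * w k = 0) :
    ∑ k ∈ range (n + 1), s (n + 1 + k) * w k = 0 := by
  classical
  have hpad : ∀ i, ∑ k ∈ range (n + 1 + 1), s (i + k) * (if k ≤ n then w k else 0) =
      ∑ k ∈ range (n + 1), s (i + k) * w k := by
    intro i
    rw [sum_range_succ, if_neg (by omega), Matrix.mul_zero, add_zero]
    refine sum_congr rfl fun k hk => ?_
    rw [if_pos (by have := mem_range.1 hk; omega)]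
  -- For the padded W the product W* H W vanishes blockwise: H W is zero in blocks 0, …, n, and W is
  -- zero in block n + 1.
  have h := mul_eq_zero_of_posSemidef
    (W := blockStack (fun k => if k ≤ n then w k else 0) (n + 1)) hs ?_
  · rw [blockHankel_mul_blockStack] at h
    rw [← hpad]
    exact blockStack_inj (w := fun _ => 0) h (n + 1) le_rfl
  · rw [blockHankel_mul_blockStack]
    ext a b
    simp only [Matrix.mul_apply, Matrix.zero_apply]
    refine sum_eq_zero fun c _ => ?_
    simp only [Matrix.conjTranspose_apply, blockStack, Matrix.of_apply, hpad]
    by_cases hc : c.1.val ≤ n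
    · rw [hw _ hc]; simp
    · simp [hc]

/-- The first n rows of the system put the block column in the range of A = H_{n-1}. The block row
is its adjoint, so A† occurs only in A A† A = A, and invertibility is not needed. -/
theorem schurComplement_eq_of_hasMonicSol {s : ℕ → Matrix (Fin q) (Fin q) ℂ} {n : ℕ}
    {L : Matrix (Fin q) (Fin q) ℂ} (hs : ∀ j ≤ 2 * n, (s j)ᴴ = s j) (h : HasMonicSol s n L) :
    schurComplement s n = L := by
  obtain ⟨p, hp1, hp0, hpL⟩ := h
  cases n with
  | zero => simpa [hp1, schurComplement] using hpL
  | succ n =>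
    have hA := conjTranspose_blockHankel (s := s) (n := n) fun j hj => hs j (by omega)
    have hcol : blockCol s (n + 1) n = -(blockHankel s n * blockStack p n) := by
      rw [blockHankel_mul_blockStack]
      ext a b
      have h1 := hp0 a.1.val a.1.isLt
      rw [sum_range_succ, hp1, mul_one, ← eq_neg_iff_add_eq_zero, ← neg_eq_iff_eq_neg] at h1
      have h2 := congrFun (congrFun h1 a.2) b
      simp only [blockCol, blockStack, Matrix.of_apply, Matrix.neg_apply] at h2 ⊢
      rw [h2, add_comm]
    have hrow : blockRow s (n + 1) n = (blockCol s (n + 1) n)ᴴ := by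
      ext a b
      have h1 := hs (n + 1 + b.1.val) (by have := b.1.isLt; omega)
      rw [blockRow, blockCol, Matrix.conjTranspose_apply, Matrix.of_apply, Matrix.of_apply,
        ← Matrix.conjTranspose_apply, h1]
    have h3 : blockRow s (n + 1) n * moorePenrose (blockHankel s n) * blockCol s (n + 1) n =
        -(blockRow s (n + 1) n * blockStack p n) := by
      rw [hrow, hcol, Matrix.conjTranspose_neg, Matrix.conjTranspose_mul, hA]
      simp only [Matrix.neg_mul, Matrix.mul_neg, neg_inj]
      have h4 := (moorePenrose_spec (blockHankel s n)).mul_mul_self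
      calc _ = (blockStack p n)ᴴ * (blockHankel s n * moorePenrose (blockHankel s n) *
            blockHankel s n) * blockStack p n := by simp only [Matrix.mul_assoc]
        _ = _ := by rw [h4]
    rw [schurComplement, h3, blockRow_mul_blockStack, ← hpL, sum_range_succ _ (n + 1), hp1,
      mul_one, sub_neg_eq_add, add_comm, two_mul]

/-- With A the preceding Hankel block and X = A†, the columns of 1 - A X are null vectors of A;
positivity makes the next block row annihilate them. Taking adjoints gives A X col = col, so (-X
col, 1) is a monic solution. -/
theorem exists_hasMonicSol_of_posSemidef {s : ℕ → Matrix (Fin q) (Fin q) ℂ} {n : ℕ}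
    (hs : (blockHankel s n).PosSemidef) : ∃ L, HasMonicSol s n L := by
  cases n with
  | zero => exact ⟨s 0, fun _ => 1, rfl, by simp, by simp⟩
  | succ n =>
    have hherm := conjTranspose_eq_of_isHermitian_blockHankel hs.1
    have hA := conjTranspose_blockHankel (s := s) (n := n) fun j hj => hherm j (by omega)
    set A := blockHankel s n with hAdef
    have hX := moorePenrose_spec A
    set X := moorePenrose A
    have hrow : blockRow s (n + 1) n = (blockCol s (n + 1) n)ᴴ := by
      ext a b
      have h1 := hherm (n + 1 + b.1.val) (by have := b.1.isLt; omega)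
      rw [blockRow, blockCol, Matrix.conjTranspose_apply, Matrix.of_apply, Matrix.of_apply,
        ← Matrix.conjTranspose_apply, h1]
    have hAM : A * (1 - A * X) = 0 := by
      rw [← Matrix.conjTranspose_eq_zero, Matrix.conjTranspose_mul, Matrix.conjTranspose_sub,
        hX.left_herm, hA, Matrix.conjTranspose_one, Matrix.sub_mul, Matrix.one_mul,
        hX.mul_mul_self, sub_self]
    obtain ⟨w, hw⟩ := blockStack_surj (1 - A * X)
    have hrowM : blockRow s (n + 1) n * (1 - A * X) = 0 := by
      rw [← hw, blockRow_mul_blockStack]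
      refine sum_mul_eq_zero_of_posSemidef hs ?_
      rw [← hw, hAdef, blockHankel_mul_blockStack] at hAM
      exact blockStack_inj (w := fun _ => 0) hAM
    have hcol : A * (X * blockCol s (n + 1) n) = blockCol s (n + 1) n := by
      rw [hrow, ← Matrix.conjTranspose_eq_zero, Matrix.conjTranspose_mul,
        Matrix.conjTranspose_sub, hX.left_herm, Matrix.conjTranspose_conjTranspose,
        Matrix.conjTranspose_one, Matrix.sub_mul, Matrix.one_mul, sub_eq_zero,
        Matrix.mul_assoc] at hrowM
      exact hrowM.symm
    obtain ⟨y, hy⟩ := blockStack_surj (X * blockCol s (n + 1) n)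
    refine ⟨_, fun k => if k ≤ n then -y k else 1, by simp, fun i hi => ?_, rfl⟩
    beta_reduce
    rw [sum_range_succ, if_neg (by omega : ¬n + 1 ≤ n), mul_one]
    have h1 : ∑ k ∈ range (n + 1), s (i + k) * (if k ≤ n then -y k else 1) =
        -∑ k ∈ range (n + 1), s (i + k) * y k := by
      rw [← sum_neg_distrib]
      refine sum_congr rfl fun k hk => ?_
      rw [if_pos (by have := mem_range.1 hk; omega), mul_neg]
    rw [← hy, hAdef, blockHankel_mul_blockStack] at hcol
    have h2 : ∑ k ∈ range (n + 1), s (i + k) * y k = s (n + 1 + i) := by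
      ext a b
      exact congrFun (congrFun hcol (⟨i, hi⟩, a)) b
    rw [h1, h2, add_comm i, neg_add_cancel]

theorem hasMonicSol_schurComplement {s : ℕ → Matrix (Fin q) (Fin q) ℂ} {n : ℕ}
    (hs : (blockHankel s n).PosSemidef) : HasMonicSol s n (schurComplement s n) := by
  obtain ⟨L, hL⟩ := exists_hasMonicSol_of_posSemidef hs
  rwa [schurComplement_eq_of_hasMonicSol (conjTranspose_eq_of_isHermitian_blockHankel hs.1) hL]

/-- The last block of a null vector of `H_n` is annihilated by the Schur complement `L_n`. -/
theorem schurComplement_mul_eq_zero {s : ℕ → Matrix (Fin q) (Fin q) ℂ} {n : ℕ}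
    (hs : (blockHankel s n).PosSemidef) {w : ℕ → Matrix (Fin q) (Fin q) ℂ}
    (hw : ∀ i ≤ n, ∑ k ∈ range (n + 1), s (i + k) * w k = 0) :
    schurComplement s n * w n = 0 := by
  have hherm := conjTranspose_eq_of_isHermitian_blockHankel hs.1
  have hA := conjTranspose_blockHankel hherm
  obtain ⟨p, hp1, hp0, hpL⟩ := hasMonicSol_schurComplement hs
  set L := schurComplement s n
  -- Since H p is concentrated in its last block, (H p)* v = L* v_n. Taking v = p shows that L is
  -- Hermitian; taking v = w gives L w_n = p* H w = 0.
  have hHp : ∀ v : ℕ → Matrix (Fin q) (Fin q) ℂ,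
      (blockHankel s n * blockStack p n)ᴴ * blockStack v n = Lᴴ * v n := by
    intro v
    rw [blockHankel_mul_blockStack, conjTranspose_blockStack_mul, sum_range_succ, hpL,
      add_eq_right]
    refine sum_eq_zero fun k hk => ?_
    rw [hp0 k (mem_range.1 hk), Matrix.conjTranspose_zero, zero_mul]
  have hL : Lᴴ = L := by
    have h1 := hHp p
    rw [hp1, mul_one] at h1
    have h2 := congrArg Matrix.conjTranspose h1
    simp only [Matrix.conjTranspose_mul, hA, Matrix.conjTranspose_conjTranspose,
      Matrix.mul_assoc] at h1 h2
    exact h1.symm.trans h2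
  rw [← hL, ← hHp w, Matrix.conjTranspose_mul, hA, Matrix.mul_assoc, blockHankel_mul_blockStack,
    blockStack_congr (w := fun _ => 0) hw]
  exact Matrix.mul_zero _

/-- If `L_n M = 0` then some null vector of `H_n` has last block `M`. -/
theorem exists_null_of_schurComplement_mul_eq_zero {s : ℕ → Matrix (Fin q) (Fin q) ℂ} {n : ℕ}
    (hs : (blockHankel s n).PosSemidef) {M : Matrix (Fin q) (Fin q) ℂ}
    (hM : schurComplement s n * M = 0) :
    ∃ w : ℕ → Matrix (Fin q) (Fin q) ℂ, w n = M ∧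
      ∀ i ≤ n, ∑ k ∈ range (n + 1), s (i + k) * w k = 0 := by
  obtain ⟨p, hp1, hp0, hpL⟩ := hasMonicSol_schurComplement hs
  refine ⟨fun k => p k * M, by simp [hp1], fun i hi => ?_⟩
  simp only [← mul_assoc]
  rw [← sum_mul]
  rcases hi.lt_or_eq with hi | rfl
  · rw [hp0 i hi, zero_mul]
  · rw [hpL, hM]

end BlockHankel
-- Recursions for the first Schur–Stieltjes transform
section SchurStep

variable {q : ℕ}

theorem conjTranspose_moorePenrose {A : Matrix (Fin q) (Fin q) ℂ} (hA : Aᴴ = A) :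
    (moorePenrose A)ᴴ = moorePenrose A := by
  have h := moorePenrose_spec A
  refine IsMoorePenrose.unique (A := A) ⟨?_, ?_, ?_, ?_⟩ h
  · have := congrArg Matrix.conjTranspose h.mul_mul_self
    simpa only [Matrix.conjTranspose_mul, hA, Matrix.mul_assoc] using this
  · have := congrArg Matrix.conjTranspose h.self_mul_mul
    simpa only [Matrix.conjTranspose_mul, hA, Matrix.mul_assoc] using this
  · have := congrArg Matrix.conjTranspose h.right_herm
    simpa only [Matrix.conjTranspose_mul, hA, Matrix.conjTranspose_conjTranspose] using this
  · have := congrArg Matrix.conjTranspose h.left_herm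
    simpa only [Matrix.conjTranspose_mul, hA, Matrix.conjTranspose_conjTranspose] using this

theorem conjTranspose_alphaShift {α : ℝ} {s : ℕ → Matrix (Fin q) (Fin q) ℂ} {j : ℕ}
    (h : (s j)ᴴ = s j) (h' : (s (j + 1))ᴴ = s (j + 1)) :
    (alphaShift (α : ℂ) s j)ᴴ = alphaShift (α : ℂ) s j := by
  simp [alphaShift, h, h', Matrix.conjTranspose_smul]

theorem stieltjesParam_two_mul (α : ℂ) (s : ℕ → Matrix (Fin q) (Fin q) ℂ) (n : ℕ) :
    stieltjesParam α s (2 * n) = schurComplement s n := by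
  rw [stieltjesParam, if_pos (even_two_mul n), Nat.mul_div_cancel_left n two_pos]

theorem stieltjesParam_two_mul_add_one (α : ℂ) (s : ℕ → Matrix (Fin q) (Fin q) ℂ) (n : ℕ) :
    stieltjesParam α s (2 * n + 1) = schurComplement (alphaShift α s) n := by
  rw [stieltjesParam, if_neg (by simp), show (2 * n + 1) / 2 = n by omega]

theorem schurComplement_congr {s s' : ℕ → Matrix (Fin q) (Fin q) ℂ} {n : ℕ}
    (h : ∀ j ≤ 2 * n, s j = s' j) : schurComplement s n = schurComplement s' n := by
  cases n with
  | zero => exact h 0 (by omega)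
  | succ n =>
    have h1 : blockHankel s n = blockHankel s' n := by
      ext a b
      simp only [blockHankel, Matrix.of_apply]
      rw [h _ (by have := a.1.isLt; have := b.1.isLt; omega)]
    have h2 : blockRow s (n + 1) n = blockRow s' (n + 1) n := by
      ext a b
      simp only [blockRow, Matrix.of_apply]
      rw [h _ (by have := b.1.isLt; omega)]
    have h3 : blockCol s (n + 1) n = blockCol s' (n + 1) n := by
      ext a b
      simp only [blockCol, Matrix.of_apply]
      rw [h _ (by have := a.1.isLt; omega)]
    rw [schurComplement, schurComplement, h1, h2, h3, h _ le_rfl]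

theorem schurComplement_succ_mul {s : ℕ → Matrix (Fin q) (Fin q) ℂ} {n : ℕ}
    {M : Matrix (Fin q) (Fin q) ℂ} (h : ∀ j < 2 * n, s j * M = 0) :
    schurComplement s n * M = s (2 * n) * M := by
  cases n with
  | zero => rfl
  | succ n =>
    have : blockCol s (n + 1) n * M = 0 := by
      ext a b
      exact congrFun (congrFun (h (n + 1 + a.1.val) (by have := a.1.isLt; omega)) a.2) b
    rw [schurComplement, Matrix.sub_mul, Matrix.mul_assoc, this, Matrix.mul_zero, sub_zero]

/-- If the null space of `s_0` is contained in those of the parameters `Q_0, …, Q_m`, then it is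
contained in those of `s_0, …, s_m`. -/
theorem mul_eq_zero_of_stieltjesParam {α : ℂ} {s : ℕ → Matrix (Fin q) (Fin q) ℂ} {m : ℕ}
    {M : Matrix (Fin q) (Fin q) ℂ} (h : ∀ j ≤ m, stieltjesParam α s j * M = 0) :
    ∀ j ≤ m, s j * M = 0 := by
  intro j
  induction j using Nat.strong_induction_on with
  | _ j ih =>
    intro hj
    have h1 := h j hj
    obtain ⟨n, rfl | rfl⟩ := Nat.even_or_odd' j
    · rwa [stieltjesParam_two_mul, schurComplement_succ_mul fun i hi => ih i hi (by omega)] at h1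
    · have hsh : ∀ i, alphaShift α s i * M = -(α • (s i * M)) + s (i + 1) * M := by
        intro i
        rw [alphaShift, Matrix.add_mul, Matrix.neg_mul, Matrix.smul_mul]
      rwa [stieltjesParam_two_mul_add_one, schurComplement_succ_mul, hsh,
        ih (2 * n) (by omega) (by omega), smul_zero, neg_zero, zero_add] at h1
      intro i hi
      rw [hsh, ih i (by omega) (by omega), ih (i + 1) (by omega) (by omega)]
      simp

/-- The algebraic properties of `α`-Stieltjes non-negative definite extendable sequences
`(s_j)_{j=0}^m` which are inherited by the first `α`-Schur-Stieltjes transform. -/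
structure IsStieltjesRegular (α : ℝ) (m : ℕ) (s : ℕ → Matrix (Fin q) (Fin q) ℂ) : Prop where
  herm : ∀ j ≤ m, (s j)ᴴ = s j
  hasMonicSol_even : ∀ n, 2 * n ≤ m → HasMonicSol s n (stieltjesParam (α : ℂ) s (2 * n))
  hasMonicSol_odd : ∀ n, 2 * n + 1 ≤ m →
    HasMonicSol (alphaShift (α : ℂ) s) n (stieltjesParam (α : ℂ) s (2 * n + 1))
  null_succ : ∀ j < m, ∀ M, stieltjesParam (α : ℂ) s j * M = 0 →
    stieltjesParam (α : ℂ) s (j + 1) * M = 0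

namespace IsStieltjesRegular

variable {α : ℝ} {m : ℕ} {s : ℕ → Matrix (Fin q) (Fin q) ℂ}

theorem null_le (h : IsStieltjesRegular α m s) {i : ℕ} {M : Matrix (Fin q) (Fin q) ℂ}
    (hM : stieltjesParam (α : ℂ) s i * M = 0) :
    ∀ j, i ≤ j → j ≤ m → stieltjesParam (α : ℂ) s j * M = 0 := by
  intro j hij
  induction j, hij using Nat.le_induction with
  | base => exact fun _ => hM
  | succ j _ ih => exact fun hj => h.null_succ j (by omega) M (ih (by omega))

/-- The columns of 1 - s_0† s_0 lie in ker Q_0 = ker s_0, hence in the kernels of all later Q_j and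
so of all s_j. -/
theorem mul_moorePenrose_mul (h : IsStieltjesRegular α m s) {j : ℕ} (hj : j ≤ m) :
    s j * (moorePenrose (s 0) * s 0) = s j := by
  have h0 : stieltjesParam (α : ℂ) s 0 = s 0 := rfl
  have hM : stieltjesParam (α : ℂ) s 0 * (1 - moorePenrose (s 0) * s 0) = 0 := by
    rw [h0, mul_sub, mul_one, ← mul_assoc, (moorePenrose_spec (s 0)).mul_mul_self, sub_self]
  have := mul_eq_zero_of_stieltjesParam (fun i hi => h.null_le hM i (Nat.zero_le i) hi) j hj
  rwa [mul_sub, mul_one, sub_eq_zero, eq_comm] at this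

theorem mul_moorePenrose_mul' (h : IsStieltjesRegular α m s) {j : ℕ} (hj : j ≤ m) :
    s 0 * (moorePenrose (s 0) * s j) = s j := by
  have h1 := congrArg Matrix.conjTranspose (h.mul_moorePenrose_mul hj)
  simpa only [Matrix.conjTranspose_mul, h.herm 0 (Nat.zero_le m), h.herm j hj,
    conjTranspose_moorePenrose (h.herm 0 (Nat.zero_le m)), Matrix.mul_assoc] using h1

end IsStieltjesRegular

theorem alphaShift_mul_of_mul {α : ℂ} {s : ℕ → Matrix (Fin q) (Fin q) ℂ} {j : ℕ}
    {P : Matrix (Fin q) (Fin q) ℂ} (h : s j * P = s j) (h' : s (j + 1) * P = s (j + 1)) :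
    alphaShift α s j * P = alphaShift α s j := by
  rw [alphaShift, Matrix.add_mul, Matrix.neg_mul, Matrix.smul_mul, h, h']

theorem mul_alphaShift_of_mul {α : ℂ} {s : ℕ → Matrix (Fin q) (Fin q) ℂ} {j : ℕ}
    {P : Matrix (Fin q) (Fin q) ℂ} (h : P * s j = s j) (h' : P * s (j + 1) = s (j + 1)) :
    P * alphaShift α s j = alphaShift α s j := by
  rw [alphaShift, Matrix.mul_add, Matrix.mul_neg, Matrix.mul_smul, h, h']

theorem schurStep_mul_moorePenrose_mul (α : ℂ) (s : ℕ → Matrix (Fin q) (Fin q) ℂ) (j : ℕ) :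
    schurStep α s j * (moorePenrose (s 0) * s 0) = schurStep α s j := by
  rw [schurStep, mul_assoc, ← mul_assoc (s 0) (moorePenrose (s 0)),
    (moorePenrose_spec (s 0)).mul_mul_self]

theorem moorePenrose_mul_reciprocalSeq (s : ℕ → Matrix (Fin q) (Fin q) ℂ) (j : ℕ) :
    moorePenrose (s 0) * (s 0 * reciprocalSeq s j) = reciprocalSeq s j := by
  cases j with
  | zero => rw [reciprocalSeq, ← mul_assoc, (moorePenrose_spec (s 0)).self_mul_mul]
  | succ j =>
    rw [reciprocalSeq, mul_neg, mul_neg, ← mul_assoc, ← mul_assoc,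
      (moorePenrose_spec (s 0)).self_mul_mul]

/-- Multiply the recursion for the reciprocal sequence by s_0 on both sides. The term l = 0 gives
a_j, and u_{l+1}^♯ s_0 = -s_0† t_l turns the others into the convolution. -/
theorem schurStep_leftRec {α : ℂ} {s : ℕ → Matrix (Fin q) (Fin q) ℂ} {N : ℕ}
    (hr : ∀ j ≤ N, alphaShift α s j * (moorePenrose (s 0) * s 0) = alphaShift α s j)
    (hl : ∀ j ≤ N, s 0 * moorePenrose (s 0) * alphaShift α s j = alphaShift α s j) :
    ∀ j ≤ N, schurStep α s j = alphaShift α s j -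
      ∑ l ∈ range j, alphaShift α s (j - 1 - l) * (moorePenrose (s 0) * schurStep α s l) := by
  intro j hj
  have hu0 : plusTransform α s 0 = s 0 := rfl
  have hu : ∀ i, plusTransform α s (i + 1) = alphaShift α s i := fun _ => rfl
  have h1 : schurStep α s j = ∑ l ∈ range (j + 1),
      alphaShift α s (j - l) * (reciprocalSeq (plusTransform α s) l * s 0) := by
    rw [schurStep, reciprocalSeq, neg_neg, Fin.sum_univ_eq_sum_range (fun l =>
      plusTransform α s (j + 1 - l) * reciprocalSeq (plusTransform α s) l), hu0, mul_sum,
      mul_sum, sum_mul]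
    refine sum_congr rfl fun l hl' => ?_
    have := mem_range.1 hl'
    rw [show j + 1 - l = j - l + 1 by omega, hu, ← mul_assoc, ← mul_assoc, hl _ (by omega),
      mul_assoc]
  rw [h1, sum_range_succ', sub_eq_add_neg, add_comm, reciprocalSeq, hu0, Nat.sub_zero, hr j hj,
    ← sum_neg_distrib]
  congr 1
  refine sum_congr rfl fun l _ => ?_
  rw [show j - (l + 1) = j - 1 - l by omega, schurStep, ← mul_neg]
  congr 1
  have h2 := moorePenrose_mul_reciprocalSeq (plusTransform α s) (l + 1)
  rw [hu0] at h2
  conv_lhs => rw [← h2]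
  noncomm_ring

/-- Taking adjoints exchanges the left and the right recursion. -/
theorem conjTranspose_of_rec {a t : ℕ → Matrix (Fin q) (Fin q) ℂ} {G : Matrix (Fin q) (Fin q) ℂ}
    {N : ℕ} (hG : Gᴴ = G) (ha : ∀ j ≤ N, (a j)ᴴ = a j)
    (hl : ∀ m ≤ N, t m = a m - ∑ l ∈ range m, a (m - 1 - l) * (G * t l))
    (hr : ∀ m ≤ N, t m = a m - ∑ l ∈ range m, t l * (G * a (m - 1 - l))) :
    ∀ j ≤ N, (t j)ᴴ = t j := by
  intro j
  induction j using Nat.strong_induction_on with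
  | _ j ih =>
    intro hj
    rw [hl j hj, Matrix.conjTranspose_sub, Matrix.conjTranspose_sum, ha j hj, ← hl j hj, hr j hj]
    congr 1
    refine sum_congr rfl fun l hl' => ?_
    have := mem_range.1 hl'
    rw [Matrix.conjTranspose_mul, Matrix.conjTranspose_mul, hG, ih l this (by omega),
      ha _ (by omega), mul_assoc]

/-- The recursion for the shifted transform `b = t^{(α)}` in terms of `s`. -/
theorem alphaShift_rec {α : ℂ} {s t : ℕ → Matrix (Fin q) (Fin q) ℂ}
    {G : Matrix (Fin q) (Fin q) ℂ} {N : ℕ}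
    (hsr : ∀ j ≤ N + 2, s j * (G * s 0) = s j) (hsl : ∀ j ≤ N + 2, s 0 * (G * s j) = s j)
    (htr : ∀ j ≤ N + 1, t j * (G * s 0) = t j)
    (hr : ∀ m ≤ N + 1, t m = alphaShift α s m -
      ∑ l ∈ range m, t l * (G * alphaShift α s (m - 1 - l))) :
    ∀ i ≤ N,
      s (i + 1) - s 1 * (G * s i) - ∑ l ∈ range i, alphaShift α t l * (G * s (i - 1 - l)) = 0 ∧
      alphaShift α t i = s (i + 2) - s 1 * (G * s (i + 1)) -
        ∑ l ∈ range i, alphaShift α t l * (G * s (i - 1 - l + 1)) := by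
  -- Both claims are coefficients of z b G s = (s - s_0)/z - s_1 G s: the first at z^i, the second
  -- at z^{i+1} with the term b_i G s_0 = b_i isolated.
  set a := alphaShift α s with hadef
  set b := alphaShift α t with hbdef
  have ha : ∀ j, a j = -(α • s j) + s (j + 1) := fun _ => rfl
  have hb : ∀ j, b j = -(α • t j) + t (j + 1) := fun _ => rfl
  have hbr : ∀ j ≤ N, b j * (G * s 0) = b j := fun j hj =>
    alphaShift_mul_of_mul (htr j (by omega)) (htr (j + 1) (by omega))
  have hal : ∀ j ≤ N, s 0 * (G * a j) = a j := fun j hj => by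
    have := mul_alphaShift_of_mul (α := α) (P := s 0 * G)
      ((mul_assoc _ _ _).trans (hsl j (by omega))) ((mul_assoc _ _ _).trans (hsl (j + 1) (by omega)))
    rwa [mul_assoc] at this
  have ht0 : t 0 = a 0 := by simpa using hr 0 (by omega)
  have hb1 : ∀ i ≤ N, b i = a (i + 1) - s 1 * (G * a i) -
      ∑ l ∈ range i, b l * (G * a (i - 1 - l)) := by
    intro i hi
    have h1 : ∑ l ∈ range i, b l * (G * a (i - 1 - l)) =
        ∑ l ∈ range i, t (l + 1) * (G * a (i - 1 - l)) -
          α • ∑ l ∈ range i, t l * (G * a (i - 1 - l)) := by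
      rw [smul_sum, ← sum_sub_distrib]
      refine sum_congr rfl fun l _ => ?_
      rw [hb, add_mul, neg_mul, smul_mul_assoc]
      abel
    have h2 : ∑ l ∈ range (i + 1), t l * (G * a (i + 1 - 1 - l)) =
        ∑ l ∈ range i, t (l + 1) * (G * a (i - 1 - l)) + a 0 * (G * a i) := by
      rw [sum_range_succ', ht0]
      congr 1
      refine sum_congr rfl fun l _ => ?_
      rw [show i + 1 - 1 - (l + 1) = i - 1 - l by omega]
    have h3 : a 0 * (G * a i) = -(α • a i) + s 1 * (G * a i) := by
      rw [ha 0, add_mul, neg_mul, smul_mul_assoc, hal i hi]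
    rw [hb, hr i (by omega), hr (i + 1) (by omega), h1, h2, h3, smul_sub]
    abel
  intro i
  induction i with
  | zero =>
    intro _
    have h0 : s 1 - s 1 * (G * s 0) = 0 := by rw [hsr 1 (by omega), sub_self]
    refine ⟨by simpa using h0, ?_⟩
    have h1 := hb1 0 (by omega)
    simp only [range_zero, sum_empty, sub_zero, ha, mul_add, mul_neg, mul_smul_comm] at h1 ⊢
    rw [h1, hsr 1 (by omega)]
    simp
  | succ i ih =>
    intro hi
    obtain ⟨-, ih⟩ := ih (by omega)
    -- The first identity at i + 1 is the second one at i.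
    have hbracket : s (i + 1 + 1) - s 1 * (G * s (i + 1)) -
        ∑ l ∈ range (i + 1), b l * (G * s (i + 1 - 1 - l)) = 0 := by
      rw [sum_range_succ, show i + 1 - 1 - i = 0 by omega, hbr i (by omega), ← sub_sub]
      rw [sub_eq_zero, ih]
      congr 1
      refine sum_congr rfl fun l hl => ?_
      have := mem_range.1 hl
      rw [show i + 1 - 1 - l = i - 1 - l + 1 by omega]
    refine ⟨hbracket, ?_⟩
    have h1 : ∑ l ∈ range (i + 1), b l * (G * a (i + 1 - 1 - l)) =
        ∑ l ∈ range (i + 1), b l * (G * s (i + 1 - 1 - l + 1)) -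
          α • ∑ l ∈ range (i + 1), b l * (G * s (i + 1 - 1 - l)) := by
      rw [smul_sum, ← sum_sub_distrib]
      refine sum_congr rfl fun l _ => ?_
      rw [ha, mul_add, mul_add, mul_neg, mul_neg, mul_smul_comm, mul_smul_comm]
      abel
    -- Expanding `a` in `hb1` gives the desired expression minus α times the vanishing bracket.
    have h2 := congrArg (α • ·) hbracket
    simp only [smul_sub, smul_zero] at h2
    rw [hb1 (i + 1) hi, h1, ha, ha, mul_add, mul_add, mul_neg, mul_neg, mul_smul_comm,
      mul_smul_comm, ← sub_eq_zero, ← neg_eq_zero, ← h2]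
    abel

end SchurStep
-- Iteration of the step and the consequences of positivity
section Main

variable {q : ℕ} {α : ℝ} {m : ℕ} {s : ℕ → Matrix (Fin q) (Fin q) ℂ}

/-- The first `α`-Schur-Stieltjes transform shifts the `α`-Stieltjes parametrization by one. -/
theorem IsStieltjesRegular.schurStep (h : IsStieltjesRegular α (m + 1) s) :
    IsStieltjesRegular α m (schurStep (α : ℂ) s) ∧
      ∀ j ≤ m, stieltjesParam (α : ℂ) (StieltjesSchur.schurStep (α : ℂ) s) j =
        stieltjesParam (α : ℂ) s (j + 1) := by
  set t := StieltjesSchur.schurStep (α : ℂ) s with ht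
  have hsr : ∀ j ≤ m + 1, s j * (moorePenrose (s 0) * s 0) = s j :=
    fun j hj => h.mul_moorePenrose_mul hj
  have hsl : ∀ j ≤ m + 1, s 0 * (moorePenrose (s 0) * s j) = s j :=
    fun j hj => h.mul_moorePenrose_mul' hj
  have hl := schurStep_leftRec (α := (α : ℂ)) (s := s) (N := m)
    (fun j hj => alphaShift_mul_of_mul (hsr j (by omega)) (hsr (j + 1) (by omega)))
    (fun j hj => mul_alphaShift_of_mul ((mul_assoc _ _ _).trans (hsl j (by omega)))
      ((mul_assoc _ _ _).trans (hsl (j + 1) (by omega))))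
  have hr := rightRec_of_leftRec hl
  rw [← ht] at hl hr
  have ht_herm : ∀ j ≤ m, (t j)ᴴ = t j :=
    conjTranspose_of_rec (conjTranspose_moorePenrose (h.herm 0 (Nat.zero_le _)))
      (fun j hj => conjTranspose_alphaShift (h.herm j (by omega)) (h.herm (j + 1) (by omega))) hl hr
  have heven : ∀ n, 2 * n ≤ m → HasMonicSol t n (stieltjesParam (α : ℂ) s (2 * n + 1)) :=
    fun n hn => HasMonicSol.of_rightRec (fun i hi => hr i (by omega))
      (h.hasMonicSol_odd n (by omega))
  have hodd : ∀ n, 2 * n + 1 ≤ m →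
      HasMonicSol (alphaShift (α : ℂ) t) n (stieltjesParam (α : ℂ) s (2 * n + 1 + 1)) := by
    intro n hn
    obtain ⟨N, rfl⟩ : ∃ N, m = N + 1 := ⟨m - 1, by omega⟩
    have hrec := alphaShift_rec hsr hsl
      (fun j _ => schurStep_mul_moorePenrose_mul (α : ℂ) s j) hr
    -- Degree n + 1 for s becomes degree n for t^{(α)}, so the residual is Q_{2n+2} of s.
    exact HasMonicSol.of_shiftedRec (fun i hi => (hrec i (by omega)).2)
      (fun i hi => (hrec i (by omega)).1) (h.hasMonicSol_even (n + 1) (by omega))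
  have hQ : ∀ j ≤ m, stieltjesParam (α : ℂ) t j = stieltjesParam (α : ℂ) s (j + 1) := by
    intro j hj
    obtain ⟨n, rfl | rfl⟩ := Nat.even_or_odd' j
    · rw [stieltjesParam_two_mul]
      exact schurComplement_eq_of_hasMonicSol (fun i hi => ht_herm i (by omega)) (heven n hj)
    · rw [stieltjesParam_two_mul_add_one]
      exact schurComplement_eq_of_hasMonicSol (fun i hi => conjTranspose_alphaShift
        (ht_herm i (by omega)) (ht_herm (i + 1) (by omega))) (hodd n hj)
  refine ⟨⟨ht_herm, fun n hn => ?_, fun n hn => ?_, fun j hj M hM => ?_⟩, hQ⟩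
  · rw [hQ _ hn]
    exact heven n hn
  · rw [hQ _ hn]
    exact hodd n hn
  · rw [hQ _ (by omega)] at hM ⊢
    exact h.null_succ (j + 1) (by omega) M hM

theorem IsStieltjesRegular.schurTransform (h : IsStieltjesRegular α m s) (k : ℕ) :
    ∀ d, k + d = m → IsStieltjesRegular α d (schurTransform (α : ℂ) s k) ∧
      ∀ j ≤ d, stieltjesParam (α : ℂ) (StieltjesSchur.schurTransform (α : ℂ) s k) j =
        stieltjesParam (α : ℂ) s (k + j) := by
  induction k with
  | zero =>
    intro d hd
    obtain rfl : d = m := by omega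
    exact ⟨h, fun j _ => by rw [zero_add]; rfl⟩
  | succ k ih =>
    intro d hd
    obtain ⟨h1, h2⟩ := ih (d + 1) (by omega)
    obtain ⟨h3, h4⟩ := h1.schurStep
    refine ⟨h3, fun j hj => (h4 j hj).trans ?_⟩
    rw [h2 _ (by omega), show k + (j + 1) = k + 1 + j by omega]

theorem sum_alphaShift_mul (α : ℂ) (s w : ℕ → Matrix (Fin q) (Fin q) ℂ) (i n : ℕ) :
    ∑ k ∈ range (n + 1), alphaShift α s (i + k) * w k =
      -(α • ∑ k ∈ range (n + 1), s (i + k) * w k) +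
        ∑ k ∈ range (n + 1), s (i + 1 + k) * w k := by
  rw [smul_sum, ← sum_neg_distrib, ← sum_add_distrib]
  refine sum_congr rfl fun k _ => ?_
  rw [alphaShift, Matrix.add_mul, Matrix.neg_mul, Matrix.smul_mul, add_right_comm i k 1]

theorem IsStieltjesNND.isStieltjesRegular (h : IsStieltjesNND α (m + 1) s) :
    IsStieltjesRegular α m s := by
  obtain ⟨h1, h2⟩ := h
  replace h2 := h2 (by omega)
  have hs : ∀ n, 2 * n ≤ m + 1 → (blockHankel s n).PosSemidef :=
    fun n hn => posSemidef_blockHankel_of_le (by omega) h1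
  have ha : ∀ n, 2 * n ≤ m → (blockHankel (alphaShift (α : ℂ) s) n).PosSemidef :=
    fun n hn => posSemidef_blockHankel_of_le (by omega) h2
  refine ⟨fun j hj => conjTranspose_eq_of_isHermitian_blockHankel h1.1 j (by omega),
    fun n hn => ?_, fun n hn => ?_, fun j hj M hM => ?_⟩
  · rw [stieltjesParam_two_mul]
    exact hasMonicSol_schurComplement (hs n (by omega))
  · rw [stieltjesParam_two_mul_add_one]
    exact hasMonicSol_schurComplement (ha n (by omega))
  · obtain ⟨n, rfl | rfl⟩ := Nat.even_or_odd' j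
    · rw [stieltjesParam_two_mul] at hM
      rw [stieltjesParam_two_mul_add_one]
      -- A null vector of H_n is also annihilated by block row n + 1, hence by the α-shifted matrix.
      -- This uses H_{n+1}, which for 2n + 1 = m involves the extending entry s_{m+1}.
      obtain ⟨w, rfl, hw⟩ := exists_null_of_schurComplement_mul_eq_zero (hs n (by omega)) hM
      have hw' := sum_mul_eq_zero_of_posSemidef (hs (n + 1) (by omega)) hw
      refine schurComplement_mul_eq_zero (ha n (by omega)) fun i hi => ?_
      rw [sum_alphaShift_mul, hw i hi]
      rcases hi.lt_or_eq with hi | rfl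
      · rw [hw (i + 1) hi]; simp
      · rw [hw']; simp
    · rw [stieltjesParam_two_mul_add_one] at hM
      rw [show 2 * n + 1 + 1 = 2 * (n + 1) by ring, stieltjesParam_two_mul]
      obtain ⟨w, rfl, hw⟩ := exists_null_of_schurComplement_mul_eq_zero (ha n (by omega)) hM
      have hw' := sum_mul_eq_zero_of_posSemidef (ha (n + 1) (by omega)) hw
      -- The vector (0, w) - α (w, 0) has last block w_n, and row i of H_{n+1} acts on it as row i
      -- of the α-shifted system acts on w; row n + 1 is covered by `hw'`.
      have hz := schurComplement_mul_eq_zero (hs (n + 1) (by omega))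
        (w := fun k => (if k = 0 then 0 else w (k - 1)) -
          (α : ℂ) • (if k ≤ n then w k else 0)) fun i hi => ?_
      · simpa using hz
      · have h3 : ∑ k ∈ range (n + 1 + 1), s (i + k) * (if k = 0 then 0 else w (k - 1)) =
            ∑ k ∈ range (n + 1), s (i + 1 + k) * w k := by
          rw [sum_range_succ', if_pos rfl, mul_zero, add_zero]
          refine sum_congr rfl fun k _ => ?_
          rw [if_neg (by omega), Nat.add_sub_cancel, show i + 1 + k = i + (k + 1) by omega]
        have h4 : ∑ k ∈ range (n + 1 + 1), s (i + k) * (if k ≤ n then w k else 0) =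
            ∑ k ∈ range (n + 1), s (i + k) * w k := by
          rw [sum_range_succ, if_neg (by omega), mul_zero, add_zero]
          refine sum_congr rfl fun k hk => ?_
          rw [if_pos (by have := mem_range.1 hk; omega)]
        have h5 : ∑ k ∈ range (n + 1), alphaShift (α : ℂ) s (i + k) * w k = 0 := by
          rcases hi.lt_or_eq with hi | rfl
          · exact hw i (by omega)
          · exact hw'
        simp only [mul_sub, mul_smul_comm, sum_sub_distrib, ← smul_sum]
        rw [h3, h4, ← h5, sum_alphaShift_mul]
        abel

theorem stieltjesParam_congr {α : ℂ} {s s' : ℕ → Matrix (Fin q) (Fin q) ℂ} {j : ℕ}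
    (h : ∀ i ≤ j, s i = s' i) : stieltjesParam α s j = stieltjesParam α s' j := by
  obtain ⟨n, rfl | rfl⟩ := Nat.even_or_odd' j
  · rw [stieltjesParam_two_mul, stieltjesParam_two_mul, schurComplement_congr h]
  · rw [stieltjesParam_two_mul_add_one, stieltjesParam_two_mul_add_one]
    refine schurComplement_congr fun i hi => ?_
    rw [alphaShift, alphaShift, h i (by omega), h (i + 1) (by omega)]

theorem HasMonicSol.congr {R : Type*} [Ring R] {s s' : ℕ → R} {n : ℕ} {L : R}
    (hs : HasMonicSol s n L) (h : ∀ j ≤ 2 * n, s j = s' j) : HasMonicSol s' n L := by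
  obtain ⟨p, hp1, hp0, hpL⟩ := hs
  have key : ∀ i ≤ n, ∑ k ∈ range (n + 1), s' (i + k) * p k =
      ∑ k ∈ range (n + 1), s (i + k) * p k := fun i hi => sum_congr rfl fun k hk => by
    rw [h _ (by have := mem_range.1 hk; omega)]
  exact ⟨p, hp1, fun i hi => (key i hi.le).trans (hp0 i hi), (key n le_rfl).trans hpL⟩

theorem IsStieltjesRegular.congr {s' : ℕ → Matrix (Fin q) (Fin q) ℂ}
    (hs : IsStieltjesRegular α m s) (h : ∀ j ≤ m, s j = s' j) : IsStieltjesRegular α m s' := by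
  have hQ : ∀ j ≤ m, stieltjesParam (α : ℂ) s j = stieltjesParam (α : ℂ) s' j :=
    fun j hj => stieltjesParam_congr fun i hi => h i (by omega)
  refine ⟨fun j hj => ?_, fun n hn => ?_, fun n hn => ?_, fun j hj M hM => ?_⟩
  · rw [← h j hj]
    exact hs.herm j hj
  · rw [← hQ _ hn]
    exact (hs.hasMonicSol_even n hn).congr fun j hj => h j (by omega)
  · rw [← hQ _ hn]
    refine (hs.hasMonicSol_odd n hn).congr fun j hj => ?_
    rw [alphaShift, alphaShift, h j (by omega), h (j + 1) (by omega)]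
  · rw [← hQ _ (by omega)] at hM ⊢
    exact hs.null_succ j hj M hM

theorem IsStieltjesNNDExt.exists_isStieltjesRegular {κ : ℕ∞} (h : IsStieltjesNNDExt α κ s)
    {l : ℕ} (hl : (l : ℕ∞) ≤ κ) : ∃ m, l ≤ m ∧ IsStieltjesRegular α m s := by
  induction κ using ENat.recTopCoe with
  | top => exact ⟨l, le_rfl, (h.2 rfl (l + 1)).isStieltjesRegular⟩
  | coe m =>
    obtain ⟨X, hX⟩ := h.1 m rfl
    -- Regularity of length m involves only entries up to index m, so the extending matrix X at
    -- index m + 1 can be discarded.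
    refine ⟨m, by exact_mod_cast hl, hX.isStieltjesRegular.congr fun j hj => ?_⟩
    rw [Function.update_of_ne (by omega)]

end Main

end StieltjesSchur

theorem theoremT1658 {q : ℕ} (α : ℝ) (κ : ℕ∞) (s : ℕ → Matrix (Fin q) (Fin q) ℂ)
    (hs : StieltjesSchur.IsStieltjesNNDExt α κ s) (k : ℕ) (hk : (k : ℕ∞) ≤ κ) :
    ∀ j : ℕ, ((k + j : ℕ) : ℕ∞) ≤ κ →
      StieltjesSchur.stieltjesParam (α : ℂ) (StieltjesSchur.schurTransform (α : ℂ) s k) j =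
        StieltjesSchur.stieltjesParam (α : ℂ) s (k + j) := by
  intro j hj
  obtain ⟨m, hm, h⟩ := hs.exists_isStieltjesRegular hj
  exact (h.schurTransform k (m - k) (by omega)).2 j (by omega)
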